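/- Tasks are performed back-to-back on frames $k=0,1,2,\dots$. The task types $S[0],S[1],\dots$ are i.i.d. with $P[S[k]=1]=q$ and $P[S[k]=0]=1-q$, where $q\in[1/4,3/4]$. On each frame a decision $(T[k],R[k])\in\mathcal D(S[k])$ (duration and reward) is made, where $\mathcal D(0)=\{(1,1)\}$ and $\mathcal D(1)=\{(x,\,2-(2-x)^2): x\in[1,2]\}$. Let $\theta^*=\theta^*(q)$ be the optimal ratio, that is, the supremum of $$\liminf_{K\to\infty}\frac{\sum_{k=0}^{K-1}E[R[k]]}{\sum_{k=0}^{K-1}E[T[k]]}$$ over all sequences of measurable decisions with $(T[k],R[k])\in\mathcal D(S[k])$ for all $k$ (causal or not, possibly using knowledge of $q$). A causal and measurable algorithm is a sequence of measurable functions $f_k:\{0,1\}^k\times[0,1]\to\mathcal D(1)$, $k\ge 0$; it makes the decisions $$(T[k],R[k])=\begin{cases}(1,1), & S[k]=0,\\ f_k\big((S[0],\dots,S[k-1]),U\big), & S[k]=1,\end{cases}$$ where $U$ is uniformly distributed on $[0,1]$ and independent of $\{S[k]\}_{k\ge0}$. **Theorem.** There is an absolute constant $c>0$ such that for every causal and measurable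 algorithm $\{f_k\}_{k\ge0}$ there is a $q\in[1/4,3/4]$ for which, when the task types are i.i.d. Bernoulli-$q$ and $U$ is an independent uniform random variable, $$\theta^*=2-\frac{2}{q}\left(-1+\sqrt{1+q}\right)$$ and the decisions of the algorithm satisfy $$\frac{\sum_{k=0}^{K-1}E[R[k]]}{\sum_{k=0}^{K-1}E[T[k]]}\le\theta^*-c\,\frac{\log K}{K}\qquad\text{for all integers } K\ge1 .$$ In particular, no causal and measurable algorithm has an optimality gap that, for every $q\in[1/4,3/4]$, is $o(\log K/K)$ as $K\to\infty$. -/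

import Mathlib

open MeasureTheory ProbabilityTheory

namespace RenewalConverse

/-- The decision set `𝒟(s)`. A decision is a pair (duration, reward): an inflexible task
(`s = 0`) forces `(1, 1)`, a flexible task (`s = 1`) allows every point of the curve
`(x, 2 - (2 - x)²)`, `x ∈ [1, 2]`. -/
def decisionSet (s : Fin 2) : Set (ℝ × ℝ) :=
  if s = 0 then {(1, 1)} else (fun x : ℝ => (x, 2 - (2 - x) ^ 2)) '' Set.Icc 1 2

/-- A causal and measurable algorithm: for every frame `k` a measurable function
`f k : {0,1}^k × [0,1] → 𝒟(1)`, to be applied to the history `(S[0], …, S[k-1])` and to the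
randomization variable `U` if task `k` is flexible. -/
structure CausalAlgorithm where
  f : ∀ k : ℕ, (Fin k → Fin 2) × unitInterval → ℝ × ℝ
  measurable_f : ∀ k, Measurable (f k)
  f_mem : ∀ k x, f k x ∈ decisionSet 1

/-- The decision `(T[k], R[k])` that the algorithm takes on frame `k`. -/
noncomputable def CausalAlgorithm.decision (A : CausalAlgorithm) {Ω : Type*}
    (S : ℕ → Ω → Fin 2) (U : Ω → unitInterval) (k : ℕ) (ω : Ω) : ℝ × ℝ :=
  if S k ω = 0 then (1, 1) else A.f k (fun i : Fin k => S i ω, U ω)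

/-- The ratio of expectations `(∑_{k<K} E[R[k]]) / (∑_{k<K} E[T[k]])`, where
`D k = (T[k], R[k])`. -/
noncomputable def expectedRatio {Ω : Type*} [MeasurableSpace Ω] (μ : Measure Ω)
    (D : ℕ → Ω → ℝ × ℝ) (K : ℕ) : ℝ :=
  (∑ k ∈ Finset.range K, ∫ ω, (D k ω).2 ∂μ) / (∑ k ∈ Finset.range K, ∫ ω, (D k ω).1 ∂μ)

/-- The optimal ratio `θ*`: the supremum of `liminf_K (∑ E[R[k]]) / (∑ E[T[k]])` over all
sequences of measurable decisions with `(T[k], R[k]) ∈ 𝒟(S[k])` for all `k`. The decisions need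
not be causal, and they may depend on the distribution of the task types. -/
noncomputable def optimalRatio {Ω : Type*} [MeasurableSpace Ω] (μ : Measure Ω)
    (S : ℕ → Ω → Fin 2) : ℝ :=
  sSup {v : ℝ | ∃ D : ℕ → Ω → ℝ × ℝ, (∀ k, Measurable (D k)) ∧
    (∀ k ω, D k ω ∈ decisionSet (S k ω)) ∧
    v = Filter.liminf (fun K => expectedRatio μ D K) Filter.atTop}

end RenewalConverse

/-!
Write `θ` for the closed form of the optimal ratio. It solves the equation saying that the
expected maximum of `r - θ t` over the decisions `(t, r)` of a frame is zero
(`expected_dual_theta`). Completing the square, a flexible decision of duration `t` misses that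
maximum by exactly `(2 - t - θ / 2) ^ 2`. Hence the gap of any sequence of decisions, times its
total expected duration, is the sum of the expected losses (`expectedRatio_eq`); this gives the
value of `θ*` (`optimalRatio_eq_theta`) and, for a causal algorithm, turns the loss of frame `k`
into `q` times the mean square error of an estimator of `θ(q) / 2` built from `k` Bernoulli
samples (`expectedLoss_decision`).

If `p` and `q` are at distance of order `1 / √k`, the Hellinger affinity of the laws of `k` samples
stays bounded below, and no estimator has both mean square errors below a small multiple of
`(p - q) ^ 2` (`CausalAlgorithm.two_point_mse`). To get a single parameter that is bad for all
horizons simultaneously, the frames are cut into blocks `[9 ^ (j - 1), 9 ^ j)`, matched with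
intervals of parameters of length `3 ^ (-j) / 2`. A point of the left third and a point of the
right third of such an interval cannot both have a small total error over the block, so all points
of one of these thirds have a total error bounded below (`CausalAlgorithm.exists_hard_third`). That
third is the interval for the next block, and the intersection of the nested intervals is a
parameter for which every block contributes a fixed amount. About `log K` blocks precede `K`.
-/

namespace RenewalConverse

/-! ### The optimal ratio and the loss of a decision -/

/-- The closed form of `θ*` for task types of parameter `q`. -/
noncomputable def theta (q : ℝ) : ℝ := 2 - 2 / q * (-1 + Real.sqrt (1 + q))

lemma theta_eq {q : ℝ} (hq : 0 < q) : theta q = 2 - 2 / (Real.sqrt (1 + q) + 1) := by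
  have hs : Real.sqrt (1 + q) ^ 2 = 1 + q := Real.sq_sqrt (by linarith)
  have h0 : 0 ≤ Real.sqrt (1 + q) := Real.sqrt_nonneg _
  unfold theta
  field_simp
  linear_combination -hs

lemma theta_mem_Icc {q : ℝ} (hq : 0 < q) : theta q ∈ Set.Icc 0 2 := by
  have h0 : 0 ≤ Real.sqrt (1 + q) := Real.sqrt_nonneg _
  rw [theta_eq hq]
  refine ⟨?_, by linarith [show 0 ≤ 2 / (Real.sqrt (1 + q) + 1) by positivity]⟩
  rw [sub_nonneg, div_le_iff₀ (by positivity)]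
  linarith

/-- `dual θ s` is the maximum of `r - θ t` over the decisions `(t, r) ∈ 𝒟(s)`, provided that
`θ / 2 ∈ [0, 1]`; a flexible task attains it at `t = 2 - θ / 2`. -/
noncomputable def dual (θ : ℝ) (s : Fin 2) : ℝ :=
  if s = 1 then 2 - 2 * θ + θ ^ 2 / 4 else 1 - θ

/-- The quadratic equation for `θ*`: the expected dual value vanishes. -/
lemma expected_dual_theta {q : ℝ} (hq : 0 < q) :
    q * dual (theta q) 1 + (1 - q) * dual (theta q) 0 = 0 := by
  have hs : Real.sqrt (1 + q) ^ 2 = 1 + q := Real.sq_sqrt (by linarith)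
  have h0 : 0 ≤ Real.sqrt (1 + q) := Real.sqrt_nonneg _
  have hq' : q = Real.sqrt (1 + q) ^ 2 - 1 := by linarith
  rw [theta_eq hq]
  generalize Real.sqrt (1 + q) = s at *
  subst hq'
  simp only [dual, if_true, zero_ne_one, if_false]
  field_simp
  ring

/-- The parameter enters `θ*` with a derivative bounded away from zero, so an algorithm that
operates well near `θ*` estimates `q`. -/
lemma abs_sub_le_abs_theta_sub {p q : ℝ} (hp : p ∈ Set.Icc (1 / 4 : ℝ) (3 / 4))
    (hq : q ∈ Set.Icc (1 / 4 : ℝ) (3 / 4)) :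
    |p - q| / 36 ≤ |theta p / 2 - theta q / 2| := by
  have key : ∀ r ∈ Set.Icc (1 / 4 : ℝ) (3 / 4), Real.sqrt (1 + r) ^ 2 = 1 + r ∧
      0 ≤ Real.sqrt (1 + r) ∧ Real.sqrt (1 + r) ≤ 2 := fun r hr =>
    ⟨Real.sq_sqrt (by linarith [hr.1]), Real.sqrt_nonneg _,
      Real.sqrt_le_iff.2 ⟨by norm_num, by linarith [hr.2]⟩⟩
  obtain ⟨hp1, hp2, hp3⟩ := key p hp
  obtain ⟨hq1, hq2, hq3⟩ := key q hq
  rw [theta_eq (by linarith [hp.1]), theta_eq (by linarith [hq.1])]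
  have hp' : p = Real.sqrt (1 + p) ^ 2 - 1 := by linarith
  have hq' : q = Real.sqrt (1 + q) ^ 2 - 1 := by linarith
  have hs : 0 < Real.sqrt (1 + p) + Real.sqrt (1 + q) := by nlinarith [hp.1, hq.1]
  generalize Real.sqrt (1 + p) = s at *
  generalize Real.sqrt (1 + q) = t at *
  have e1 : (2 - 2 / (s + 1)) / 2 - (2 - 2 / (t + 1)) / 2 = (s - t) / ((s + 1) * (t + 1)) := by
    field_simp
    ring
  have e2 : p - q = (s - t) * (s + t) := by rw [hp', hq']; ring
  rw [e1, e2, abs_mul, abs_div, abs_of_pos hs,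
    abs_of_pos (show (0 : ℝ) < (s + 1) * (t + 1) by positivity), div_le_div_iff₀ (by norm_num)
      (by positivity), mul_assoc]
  gcongr
  calc (s + t) * ((s + 1) * (t + 1)) ≤ (2 + 2) * ((2 + 1) * (2 + 1)) := by gcongr
    _ = 36 := by norm_num

lemma mem_Icc_of_mem_decisionSet {s : Fin 2} {d : ℝ × ℝ} (hd : d ∈ decisionSet s) :
    d.1 ∈ Set.Icc 1 2 ∧ d.2 ∈ Set.Icc 1 2 := by
  unfold decisionSet at hd
  split_ifs at hd
  · rw [Set.mem_singleton_iff] at hd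
    subst hd
    norm_num
  · obtain ⟨x, hx, rfl⟩ := hd
    exact ⟨hx, by nlinarith [hx.1, hx.2], by nlinarith [hx.1, hx.2]⟩

/-- Completing the square: a flexible decision of duration `t` falls short of the dual value by
`(2 - t - θ / 2) ^ 2`. -/
lemma sub_mul_eq_dual_sub {θ : ℝ} {s : Fin 2} {d : ℝ × ℝ} (hd : d ∈ decisionSet s) :
    d.2 - θ * d.1 = dual θ s - if s = 1 then (2 - d.1 - θ / 2) ^ 2 else 0 := by
  unfold decisionSet at hd
  obtain rfl | rfl : s = 0 ∨ s = 1 := by omega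
  · rw [if_pos rfl, Set.mem_singleton_iff] at hd
    subst hd
    simp [dual]
  · rw [if_neg one_ne_zero] at hd
    obtain ⟨x, -, rfl⟩ := hd
    simp only [dual, if_true]
    ring

lemma CausalAlgorithm.decision_mem (A : CausalAlgorithm) {Ω : Type*} (S : ℕ → Ω → Fin 2)
    (U : Ω → unitInterval) (k : ℕ) (ω : Ω) : A.decision S U k ω ∈ decisionSet (S k ω) := by
  unfold CausalAlgorithm.decision
  split_ifs with h
  · simp [h, decisionSet]
  · rw [show S k ω = 1 by omega]
    exact A.f_mem _ _

lemma CausalAlgorithm.measurable_decision (A : CausalAlgorithm) {Ω : Type*} [MeasurableSpace Ω]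
    {S : ℕ → Ω → Fin 2} {U : Ω → unitInterval} (hS : ∀ k, Measurable (S k)) (hU : Measurable U)
    (k : ℕ) : Measurable (A.decision S U k) := by
  unfold CausalAlgorithm.decision
  refine Measurable.ite (hS k (measurableSet_singleton 0)) measurable_const ?_
  exact (A.measurable_f k).comp
    ((measurable_pi_lambda _ fun i : Fin k => hS i).prodMk hU)

lemma measurable_dual (θ : ℝ) : Measurable (dual θ) := measurable_of_finite _

lemma integrable_of_mem_Icc {Ω : Type*} [MeasurableSpace Ω] {μ : Measure Ω} [IsFiniteMeasure μ]
    {f : Ω → ℝ} (hf : Measurable f) {a b : ℝ} (h : ∀ ω, f ω ∈ Set.Icc a b) : Integrable f μ :=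
  Integrable.of_mem_Icc a b hf.aemeasurable (ae_of_all _ h)

/-! ### The optimality gap as a sum of expected losses -/

/-- The expected loss of frame `k` against the decision that is optimal for the parameter `q`. -/
noncomputable def expectedLoss {Ω : Type*} [MeasurableSpace Ω] (μ : Measure Ω) (S : ℕ → Ω → Fin 2)
    (D : ℕ → Ω → ℝ × ℝ) (q : ℝ) (k : ℕ) : ℝ :=
  ∫ ω, (if S k ω = 1 then (2 - (D k ω).1 - theta q / 2) ^ 2 else 0) ∂μ

lemma expectedLoss_nonneg {Ω : Type*} [MeasurableSpace Ω] (μ : Measure Ω) (S : ℕ → Ω → Fin 2)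
    (D : ℕ → Ω → ℝ × ℝ) (q : ℝ) (k : ℕ) : 0 ≤ expectedLoss μ S D q k :=
  integral_nonneg fun ω => by
    dsimp only
    split_ifs
    · positivity
    · rfl

section Gap

variable {Ω : Type*} [MeasurableSpace Ω] {μ : Measure Ω} [IsProbabilityMeasure μ]
  {S : ℕ → Ω → Fin 2} {q : ℝ}

lemma integral_dual_theta (hS : ∀ k, Measurable (S k)) (hq : q ∈ Set.Ioo (0 : ℝ) 1)
    (hlaw : ∀ k, μ {ω | S k ω = 1} = ENNReal.ofReal q) (k : ℕ) :
    ∫ ω, dual (theta q) (S k ω) ∂μ = 0 := by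
  have hset : MeasurableSet {ω | S k ω = 1} := hS k (measurableSet_singleton 1)
  have hfun : (fun ω => dual (theta q) (S k ω)) = fun ω => dual (theta q) 0 +
      {ω | S k ω = 1}.indicator (fun _ => dual (theta q) 1 - dual (theta q) 0) ω := by
    ext ω
    by_cases h : S k ω = 1
    · simp [h]
    · simp [show S k ω = 0 by omega]
  rw [hfun, integral_add (integrable_const _) ((integrable_const _).indicator hset),
    integral_indicator_const _ hset, Measure.real, hlaw, ENNReal.toReal_ofReal hq.1.le]
  simp only [integral_const, probReal_univ, smul_eq_mul]
  linarith [expected_dual_theta hq.1]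

variable {D : ℕ → Ω → ℝ × ℝ}

lemma integrable_fst_decision (hD : ∀ k, Measurable (D k))
    (hmem : ∀ k ω, D k ω ∈ decisionSet (S k ω)) (k : ℕ) : Integrable (fun ω => (D k ω).1) μ :=
  integrable_of_mem_Icc (hD k).fst fun ω => (mem_Icc_of_mem_decisionSet (hmem k ω)).1

lemma integrable_snd_decision (hD : ∀ k, Measurable (D k))
    (hmem : ∀ k ω, D k ω ∈ decisionSet (S k ω)) (k : ℕ) : Integrable (fun ω => (D k ω).2) μ :=
  integrable_of_mem_Icc (hD k).snd fun ω => (mem_Icc_of_mem_decisionSet (hmem k ω)).2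

/-- The total expected duration of the first `K` tasks. -/
noncomputable def totalDuration (μ : Measure Ω) (D : ℕ → Ω → ℝ × ℝ) (K : ℕ) : ℝ :=
  ∑ k ∈ Finset.range K, ∫ ω, (D k ω).1 ∂μ

lemma totalDuration_mem_Icc (hD : ∀ k, Measurable (D k))
    (hmem : ∀ k ω, D k ω ∈ decisionSet (S k ω)) (K : ℕ) :
    totalDuration μ D K ∈ Set.Icc (K : ℝ) (2 * K) := by
  have h : ∀ k, 1 ≤ ∫ ω, (D k ω).1 ∂μ ∧ ∫ ω, (D k ω).1 ∂μ ≤ 2 := fun k => by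
    have hi := integrable_fst_decision (μ := μ) hD hmem k
    constructor
    · simpa using integral_mono (integrable_const (1 : ℝ)) hi
        fun ω => (mem_Icc_of_mem_decisionSet (hmem k ω)).1.1
    · simpa using integral_mono hi (integrable_const (2 : ℝ))
        fun ω => (mem_Icc_of_mem_decisionSet (hmem k ω)).1.2
  unfold totalDuration
  constructor
  · simpa using Finset.sum_le_sum fun k (_ : k ∈ Finset.range K) => (h k).1
  · simpa [mul_comm] using Finset.sum_le_sum fun k (_ : k ∈ Finset.range K) => (h k).2

lemma integral_snd_sub_theta_mul (hS : ∀ k, Measurable (S k)) (hq : q ∈ Set.Ioo (0 : ℝ) 1)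
    (hlaw : ∀ k, μ {ω | S k ω = 1} = ENNReal.ofReal q) (hD : ∀ k, Measurable (D k))
    (hmem : ∀ k ω, D k ω ∈ decisionSet (S k ω)) (k : ℕ) :
    ∫ ω, (D k ω).2 ∂μ - theta q * ∫ ω, (D k ω).1 ∂μ = -expectedLoss μ S D q k := by
  have h1 := integrable_fst_decision (μ := μ) hD hmem k
  have h2 := integrable_snd_decision (μ := μ) hD hmem k
  have hd : Integrable (fun ω => dual (theta q) (S k ω)) μ :=
    integrable_of_mem_Icc (a := min (dual (theta q) 0) (dual (theta q) 1))
      (b := max (dual (theta q) 0) (dual (theta q) 1)) ((measurable_dual _).comp (hS k)) fun ω => by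
        obtain h | h : S k ω = 0 ∨ S k ω = 1 := by omega
        all_goals simp [h]
  rw [← integral_const_mul, ← integral_sub h2 (h1.const_mul _), expectedLoss, ← integral_neg]
  have hl : (fun ω => -if S k ω = 1 then (2 - (D k ω).1 - theta q / 2) ^ 2 else 0) =
      fun ω => (D k ω).2 - theta q * (D k ω).1 - dual (theta q) (S k ω) := by
    ext ω
    rw [sub_mul_eq_dual_sub (hmem k ω)]
    ring
  have hsub : Integrable (fun ω => (D k ω).2 - theta q * (D k ω).1) μ := h2.sub (h1.const_mul _)
  rw [hl, integral_sub hsub hd, integral_dual_theta hS hq hlaw, sub_zero]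

lemma expectedRatio_eq (hS : ∀ k, Measurable (S k)) (hq : q ∈ Set.Ioo (0 : ℝ) 1)
    (hlaw : ∀ k, μ {ω | S k ω = 1} = ENNReal.ofReal q) (hD : ∀ k, Measurable (D k))
    (hmem : ∀ k ω, D k ω ∈ decisionSet (S k ω)) {K : ℕ} (hK : 1 ≤ K) :
    expectedRatio μ D K = theta q -
      (∑ k ∈ Finset.range K, expectedLoss μ S D q k) / totalDuration μ D K := by
  have hpos : 0 < totalDuration μ D K :=
    lt_of_lt_of_le (by exact_mod_cast hK) (totalDuration_mem_Icc hD hmem K).1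
  have hsum := Finset.sum_congr (rfl : Finset.range K = _) fun k _ =>
    integral_snd_sub_theta_mul hS hq hlaw hD hmem k
  rw [Finset.sum_sub_distrib, ← Finset.mul_sum, Finset.sum_neg_distrib] at hsum
  rw [expectedRatio, ← totalDuration, eq_sub_iff_add_eq, ← add_div, div_eq_iff hpos.ne']
  unfold totalDuration
  linarith

/-- The closed form of `θ*`: losses are nonnegative, and the decision of duration `2 - θ* / 2` on
every flexible task has none. -/
lemma optimalRatio_eq_theta (hS : ∀ k, Measurable (S k)) (hq : q ∈ Set.Ioo (0 : ℝ) 1)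
    (hlaw : ∀ k, μ {ω | S k ω = 1} = ENNReal.ofReal q) : optimalRatio μ S = theta q := by
  refine IsGreatest.csSup_eq ⟨?_, ?_⟩
  · let D : ℕ → Ω → ℝ × ℝ := fun k ω =>
      if S k ω = 0 then (1, 1) else (2 - theta q / 2, 2 - (theta q / 2) ^ 2)
    have hD : ∀ k, Measurable (D k) := fun k =>
      Measurable.ite (hS k (measurableSet_singleton 0)) measurable_const measurable_const
    have hmem : ∀ k ω, D k ω ∈ decisionSet (S k ω) := fun k ω => by
      have ht := theta_mem_Icc hq.1
      by_cases h : S k ω = 0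
      · simp [D, decisionSet, h]
      · simp only [D, decisionSet, h, if_false]
        exact ⟨2 - theta q / 2, ⟨by linarith [ht.2], by linarith [ht.1]⟩, by simp⟩
    refine ⟨D, hD, hmem, (Filter.Tendsto.liminf_eq (tendsto_const_nhds.congr' ?_)).symm⟩
    filter_upwards [Filter.eventually_ge_atTop 1] with K hK
    rw [expectedRatio_eq hS hq hlaw hD hmem hK, Finset.sum_eq_zero, zero_div, sub_zero]
    intro k _
    refine integral_eq_zero_of_ae (ae_of_all _ fun ω => ?_)
    by_cases h : S k ω = 1 <;> simp [D, h]
  · rintro v ⟨D, hD, hmem, rfl⟩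
    have hle : ∀ K ≥ 1, expectedRatio μ D K ≤ theta q := fun K hK => by
      rw [expectedRatio_eq hS hq hlaw hD hmem hK, sub_le_self_iff]
      exact div_nonneg (Finset.sum_nonneg fun k _ => expectedLoss_nonneg μ S D q k)
        ((Nat.cast_nonneg K).trans (totalDuration_mem_Icc hD hmem K).1)
    have hge : ∀ K, 0 ≤ expectedRatio μ D K := fun K => by
      refine div_nonneg (Finset.sum_nonneg fun k _ => integral_nonneg fun ω => ?_)
        ((Nat.cast_nonneg K).trans (totalDuration_mem_Icc (μ := μ) hD hmem K).1)
      exact zero_le_one.trans (mem_Icc_of_mem_decisionSet (hmem k ω)).2.1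
    refine Filter.liminf_le_of_frequently_le
      ((Filter.eventually_ge_atTop 1).mono hle).frequently ?_
    exact Filter.isBoundedUnder_of ⟨0, hge⟩

end Gap

/-! ### The loss as a mean square error of an estimator -/

/-- The probability of the 0-1 sequence `x` under i.i.d. Bernoulli-`q` sampling. -/
noncomputable def bernoulliWeight (q : ℝ) {n : ℕ} (x : Fin n → Fin 2) : ℝ :=
  ∏ i, if x i = 1 then q else 1 - q

lemma bernoulliWeight_nonneg {q : ℝ} (hq : q ∈ Set.Icc (0 : ℝ) 1) {n : ℕ} (x : Fin n → Fin 2) :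
    0 ≤ bernoulliWeight q x :=
  Finset.prod_nonneg fun i _ => by split_ifs <;> linarith [hq.1, hq.2]

/-- Sums of a product function over all 0-1 sequences factor. -/
lemma sum_prod_ite (n : ℕ) (a b : ℝ) :
    ∑ x : Fin n → Fin 2, ∏ i, (if x i = 1 then a else b) = (a + b) ^ n := by
  have h := (Finset.prod_univ_sum (fun _ : Fin n => (Finset.univ : Finset (Fin 2)))
    fun _ s => if s = 1 then a else b).symm
  rw [Fintype.piFinset_univ] at h
  rw [h]
  simp [Fin.sum_univ_two, add_comm]

lemma sum_bernoulliWeight (q : ℝ) (n : ℕ) : ∑ x : Fin n → Fin 2, bernoulliWeight q x = 1 := by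
  unfold bernoulliWeight
  rw [sum_prod_ite]
  simp

lemma sum_bernoulliWeight_succ (q : ℝ) {n : ℕ} (φ : (Fin n → Fin 2) → Fin 2 → ℝ) :
    ∑ x : Fin (n + 1) → Fin 2, bernoulliWeight q x * φ (fun i => x i.castSucc) (x (Fin.last n)) =
      ∑ x : Fin n → Fin 2, bernoulliWeight q x * (q * φ x 1 + (1 - q) * φ x 0) := by
  rw [← (Fin.snocEquiv fun _ => Fin 2).sum_comp, Fintype.sum_prod_type_right]
  refine Finset.sum_congr rfl fun x _ => ?_
  simp only [Fin.sum_univ_two, bernoulliWeight, Fin.prod_univ_castSucc, Fin.snocEquiv_apply,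
    Fin.snoc_castSucc, Fin.snoc_last, if_true, zero_ne_one, if_false]
  ring

/-- The mean square error at parameter `q` of the estimator `2 - T[k]` of `θ* / 2` that the
algorithm forms from `k` observations and the randomization. -/
noncomputable def CausalAlgorithm.mse (A : CausalAlgorithm) (q : ℝ) (k : ℕ) : ℝ :=
  ∫ u : unitInterval, ∑ x : Fin k → Fin 2,
    bernoulliWeight q x * (2 - (A.f k (x, u)).1 - theta q / 2) ^ 2

section Law

variable {Ω : Type*} [MeasurableSpace Ω] {μ : Measure Ω} [IsProbabilityMeasure μ]
  {S : ℕ → Ω → Fin 2} {U : Ω → unitInterval} {q : ℝ}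

lemma map_history_real_singleton (hS : ∀ k, Measurable (S k)) (hind : iIndepFun S μ)
    (hq : q ∈ Set.Icc (0 : ℝ) 1) (hlaw : ∀ k, μ {ω | S k ω = 1} = ENNReal.ofReal q)
    {n : ℕ} (x : Fin n → Fin 2) :
    (μ.map fun ω (i : Fin n) => S i ω).real {x} = bernoulliWeight q x := by
  have hone : ∀ k, μ.real {ω | S k ω = 1} = q := fun k => by
    rw [Measure.real, hlaw, ENNReal.toReal_ofReal hq.1]
  have hind' : iIndepFun (fun i : Fin n => S i) μ := hind.precomp Fin.val_injective
  have h := (iIndepFun_iff_map_fun_eq_pi_map fun i : Fin n => (hS i).aemeasurable).1 hind'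
  rw [h, Measure.real, Measure.pi_singleton, ENNReal.toReal_prod]
  refine Finset.prod_congr rfl fun i _ => ?_
  rw [Measure.map_apply (hS i) (measurableSet_singleton _)]
  obtain hx | hx : x i = 1 ∨ x i = 0 := by omega
  · rw [hx, if_pos rfl]
    exact hone i
  · have hset : MeasurableSet {ω | S i ω = 1} := hS i (measurableSet_singleton 1)
    rw [hx, if_neg zero_ne_one, ← hone i, ← probReal_compl_eq_one_sub hset, Measure.real]
    congr 2
    ext ω
    simp only [Set.mem_preimage, Set.mem_singleton_iff, Set.mem_compl_iff, Set.mem_ofPred_eq]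
    omega

lemma integral_history (hS : ∀ k, Measurable (S k)) (hind : iIndepFun S μ)
    (hq : q ∈ Set.Icc (0 : ℝ) 1) (hlaw : ∀ k, μ {ω | S k ω = 1} = ENNReal.ofReal q)
    (hU : Measurable U) (hUlaw : μ.map U = volume) (hUS : IndepFun U (fun ω k => S k ω) μ)
    {n : ℕ} {φ : (Fin n → Fin 2) × unitInterval → ℝ} (hφ : Measurable φ) {a b : ℝ}
    (hab : ∀ z, φ z ∈ Set.Icc a b) :
    ∫ ω, φ (fun i => S i ω, U ω) ∂μ =
      ∫ u : unitInterval, ∑ x : Fin n → Fin 2, bernoulliWeight q x * φ (x, u) := by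
  have hX : Measurable fun ω (i : Fin n) => S i ω := measurable_pi_lambda _ fun i => hS i
  have hXU : IndepFun (fun ω (i : Fin n) => S i ω) U μ :=
    (hUS.comp (φ := id) (ψ := fun s (i : Fin n) => s i) measurable_id
      (measurable_pi_lambda _ fun i => measurable_pi_apply _)).symm
  have := Measure.isProbabilityMeasure_map (μ := μ) hX.aemeasurable
  have hmap := hXU.map_prod_eq_prod_map_map hX.aemeasurable hU.aemeasurable
  rw [hUlaw] at hmap
  rw [← integral_map (φ := fun ω => ((fun i : Fin n => S i ω), U ω)) (hX.prodMk hU).aemeasurable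
    hφ.aestronglyMeasurable, hmap, integral_prod_symm _ (integrable_of_mem_Icc hφ hab)]
  congr 1
  ext u
  rw [integral_fintype (integrable_of_mem_Icc (by fun_prop) fun x => hab (x, u))]
  simp only [map_history_real_singleton hS hind hq hlaw, smul_eq_mul]

lemma sq_error_mem_Icc (A : CausalAlgorithm) (hq : 0 < q) {k : ℕ}
    (z : (Fin k → Fin 2) × unitInterval) :
    (2 - (A.f k z).1 - theta q / 2) ^ 2 ∈ Set.Icc 0 1 := by
  have h1 := (mem_Icc_of_mem_decisionSet (A.f_mem k z)).1
  have h2 := theta_mem_Icc hq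
  refine ⟨sq_nonneg _, ?_⟩
  rw [sq_le_one_iff_abs_le_one, abs_le]
  constructor <;> linarith [h1.1, h1.2, h2.1, h2.2]

/-- Task `k` is independent of the history and of the randomization, so the loss of frame `k`
is the mean square error times the probability of a flexible task. -/
lemma expectedLoss_decision (A : CausalAlgorithm) (hS : ∀ k, Measurable (S k))
    (hind : iIndepFun S μ) (hq : q ∈ Set.Ioo (0 : ℝ) 1)
    (hlaw : ∀ k, μ {ω | S k ω = 1} = ENNReal.ofReal q)
    (hU : Measurable U) (hUlaw : μ.map U = volume) (hUS : IndepFun U (fun ω k => S k ω) μ)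
    (k : ℕ) : expectedLoss μ S (A.decision S U) q k = q * A.mse q k := by
  let g : (Fin k → Fin 2) × unitInterval → ℝ := fun z => (2 - (A.f k z).1 - theta q / 2) ^ 2
  have hg : Measurable g := (((A.measurable_f k).fst.const_sub 2).sub_const _).pow_const 2
  let φ : (Fin (k + 1) → Fin 2) × unitInterval → ℝ := fun z =>
    if z.1 (Fin.last k) = 1 then g (fun i => z.1 i.castSucc, z.2) else 0
  have hφ : Measurable φ := by
    refine Measurable.ite ?_ (hg.comp ?_) measurable_const
    · exact ((measurable_pi_apply _).comp measurable_fst) (measurableSet_singleton 1)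
    · exact (measurable_pi_lambda _ fun i => (measurable_pi_apply _).comp measurable_fst).prodMk
        measurable_snd
  have hmem : ∀ z, φ z ∈ Set.Icc (0 : ℝ) 1 := fun z => by
    dsimp only [φ]
    split_ifs
    · exact sq_error_mem_Icc A hq.1 _
    · simp
  have h := integral_history hS hind ⟨hq.1.le, hq.2.le⟩ hlaw hU hUlaw hUS hφ hmem
  have hl : expectedLoss μ S (A.decision S U) q k = ∫ ω, φ (fun i => S i ω, U ω) ∂μ := by
    unfold expectedLoss
    congr 1
    ext ω
    by_cases hs : S k ω = 1
    · simp [φ, g, hs, CausalAlgorithm.decision]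
    · simp [φ, hs]
  rw [hl, h, CausalAlgorithm.mse, ← integral_const_mul]
  congr 1
  ext u
  have := sum_bernoulliWeight_succ q (n := k) fun x s => if s = 1 then g (x, u) else 0
  refine this.trans ?_
  rw [Finset.mul_sum]
  refine Finset.sum_congr rfl fun x _ => ?_
  simp only [if_true, zero_ne_one, if_false, g]
  ring

end Law

/-! ### Two nearby parameters cannot both be estimated well -/

/-- The Hellinger affinity of two Bernoulli distributions. -/
noncomputable def affinity (p q : ℝ) : ℝ := Real.sqrt (p * q) + Real.sqrt ((1 - p) * (1 - q))

/-- On `[1/4, 3/4]` the affinity is `1` up to a quadratic error, because square roots are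
Lipschitz there. -/
lemma one_sub_sq_le_affinity {p q : ℝ} (hp : p ∈ Set.Icc (1 / 4 : ℝ) (3 / 4))
    (hq : q ∈ Set.Icc (1 / 4 : ℝ) (3 / 4)) : 1 - (p - q) ^ 2 ≤ affinity p q := by
  have key : ∀ a b : ℝ, 1 / 4 ≤ a → 1 / 4 ≤ b →
      (a + b) / 2 - (a - b) ^ 2 / 2 ≤ Real.sqrt (a * b) := fun a b ha hb => by
    rw [Real.sqrt_mul (by linarith)]
    have ha' : 1 / 2 ≤ Real.sqrt a := Real.le_sqrt_of_sq_le (by linarith)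
    have hb' : 1 / 2 ≤ Real.sqrt b := Real.le_sqrt_of_sq_le (by linarith)
    have e1 := Real.sq_sqrt (show 0 ≤ a by linarith)
    have e2 := Real.sq_sqrt (show 0 ≤ b by linarith)
    generalize Real.sqrt a = s at *
    generalize Real.sqrt b = t at *
    subst e1 e2
    have : (s - t) ^ 2 * 1 ≤ (s - t) ^ 2 * (s + t) ^ 2 := by
      gcongr
      nlinarith
    nlinarith
  have h1 := key p q hp.1 hq.1
  have h2 := key (1 - p) (1 - q) (by linarith [hp.2]) (by linarith [hq.2])
  unfold affinity
  nlinarith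

lemma sum_sqrt_bernoulliWeight {p q : ℝ} (hp : p ∈ Set.Icc (0 : ℝ) 1)
    (hq : q ∈ Set.Icc (0 : ℝ) 1) (n : ℕ) :
    ∑ x : Fin n → Fin 2, Real.sqrt (bernoulliWeight p x) * Real.sqrt (bernoulliWeight q x) =
      affinity p q ^ n := by
  unfold affinity
  rw [← sum_prod_ite]
  refine Finset.sum_congr rfl fun x _ => ?_
  rw [← Real.sqrt_mul (bernoulliWeight_nonneg hp x), bernoulliWeight, bernoulliWeight,
    ← Finset.prod_mul_distrib, Real.sqrt_prod]
  · refine Finset.prod_congr rfl fun i _ => ?_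
    split_ifs <;> rfl
  · intro i _
    have := hp.1; have := hp.2; have := hq.1; have := hq.2
    split_ifs
    · positivity
    · exact mul_nonneg (by linarith) (by linarith)

lemma sum_sqrt_mul_abs_le {p q : ℝ} (hp : p ∈ Set.Icc (0 : ℝ) 1) (hq : q ∈ Set.Icc (0 : ℝ) 1)
    {n : ℕ} (g : (Fin n → Fin 2) → ℝ) :
    (∑ x, Real.sqrt (bernoulliWeight p x) * Real.sqrt (bernoulliWeight q x) * |g x|) ^ 2 ≤
      ∑ x, bernoulliWeight p x * g x ^ 2 := by
  have h := Finset.sum_mul_sq_le_sq_mul_sq Finset.univ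
    (fun x => Real.sqrt (bernoulliWeight p x) * |g x|) fun x => Real.sqrt (bernoulliWeight q x)
  simp only [mul_pow, Real.sq_sqrt (bernoulliWeight_nonneg hp _),
    Real.sq_sqrt (bernoulliWeight_nonneg hq _), sum_bernoulliWeight, mul_one, sq_abs] at h
  refine le_trans (le_of_eq ?_) h
  congr 1
  exact Finset.sum_congr rfl fun x _ => by ring

/-- Le Cam's two-point bound for one estimator `g`. By Cauchy-Schwarz, the average of `|g - a|`
against the geometric mean of the two laws is at most the root mean square error at `p`, and
similarly for `b` and `q`; the two averages add up to at least `|a - b|` times the affinity. -/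
lemma two_point_bound {p q : ℝ} (hp : p ∈ Set.Icc (0 : ℝ) 1) (hq : q ∈ Set.Icc (0 : ℝ) 1)
    {n : ℕ} (g : (Fin n → Fin 2) → ℝ) (a b : ℝ) :
    (|a - b| * affinity p q ^ n) ^ 2 / 2 ≤
      ∑ x, bernoulliWeight p x * (g x - a) ^ 2 + ∑ x, bernoulliWeight q x * (g x - b) ^ 2 := by
  have h1 := sum_sqrt_mul_abs_le hp hq fun x => g x - a
  have h2 := sum_sqrt_mul_abs_le hq hp fun x => g x - b
  set X := ∑ x, Real.sqrt (bernoulliWeight p x) * Real.sqrt (bernoulliWeight q x) * |g x - a|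
  set Y := ∑ x, Real.sqrt (bernoulliWeight q x) * Real.sqrt (bernoulliWeight p x) * |g x - b|
  have h3 : |a - b| * affinity p q ^ n ≤ X + Y := by
    rw [← sum_sqrt_bernoulliWeight hp hq, Finset.mul_sum, ← Finset.sum_add_distrib]
    refine Finset.sum_le_sum fun x _ => ?_
    have h : |a - b| ≤ |g x - a| + |g x - b| := by
      rw [abs_sub_comm (g x) a]
      exact abs_sub_le a (g x) b
    calc |a - b| * (Real.sqrt (bernoulliWeight p x) * Real.sqrt (bernoulliWeight q x))
        ≤ (|g x - a| + |g x - b|) *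
          (Real.sqrt (bernoulliWeight p x) * Real.sqrt (bernoulliWeight q x)) := by gcongr
      _ = _ := by ring
  have h4 : 0 ≤ |a - b| * affinity p q ^ n := by
    have : 0 ≤ affinity p q := add_nonneg (Real.sqrt_nonneg _) (Real.sqrt_nonneg _)
    positivity
  have h5 : (|a - b| * affinity p q ^ n) ^ 2 ≤ (X + Y) ^ 2 := by gcongr
  nlinarith [sq_nonneg (X - Y)]

lemma CausalAlgorithm.integrable_sq_error (A : CausalAlgorithm) {q : ℝ} (hq : 0 < q) (k : ℕ) :
    Integrable (fun u : unitInterval => ∑ x : Fin k → Fin 2,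
      bernoulliWeight q x * (2 - (A.f k (x, u)).1 - theta q / 2) ^ 2) volume := by
  refine integrable_finsetSum _ fun x _ => Integrable.const_mul ?_ _
  refine integrable_of_mem_Icc ?_ fun u => sq_error_mem_Icc A hq (x, u)
  exact ((((A.measurable_f k).comp measurable_prodMk_left).fst.const_sub 2).sub_const _).pow_const 2

lemma CausalAlgorithm.mse_nonneg (A : CausalAlgorithm) {q : ℝ} (hq : q ∈ Set.Icc (0 : ℝ) 1)
    (k : ℕ) : 0 ≤ A.mse q k :=
  integral_nonneg fun _ => Finset.sum_nonneg fun x _ =>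
    mul_nonneg (bernoulliWeight_nonneg hq x) (sq_nonneg _)

/-- As long as `k` is at most of order `(p - q) ^ (-2)`, the affinity of the laws of `k` samples is
at least `3 / 4`, and the two-point bound applies for each value of the randomization. -/
lemma CausalAlgorithm.two_point_mse (A : CausalAlgorithm) {p q : ℝ}
    (hp : p ∈ Set.Icc (1 / 4 : ℝ) (3 / 4)) (hq : q ∈ Set.Icc (1 / 4 : ℝ) (3 / 4)) {k : ℕ}
    (hk : k * (p - q) ^ 2 ≤ 1 / 4) :
    (p - q) ^ 2 / 4608 ≤ A.mse p k + A.mse q k := by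
  have hp' : p ∈ Set.Icc (0 : ℝ) 1 := ⟨by linarith [hp.1], by linarith [hp.2]⟩
  have hq' : q ∈ Set.Icc (0 : ℝ) 1 := ⟨by linarith [hq.1], by linarith [hq.2]⟩
  have hp0 : 0 < p := by linarith [hp.1]
  have hq0 : 0 < q := by linarith [hq.1]
  have hsq : (p - q) ^ 2 ≤ 1 / 4 := by nlinarith [hp.1, hp.2, hq.1, hq.2]
  have haff : 3 / 4 ≤ affinity p q ^ k := by
    calc (3 / 4 : ℝ) ≤ 1 + k * (-(p - q) ^ 2) := by linarith
      _ ≤ (1 + -(p - q) ^ 2) ^ k := one_add_mul_le_pow (by linarith) k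
      _ ≤ affinity p q ^ k := by
        have := one_sub_sq_le_affinity hp hq
        gcongr
        · linarith
        · linarith
  have hd := abs_sub_le_abs_theta_sub hp hq
  have hconst : (p - q) ^ 2 / 4608 ≤
      (|theta p / 2 - theta q / 2| * affinity p q ^ k) ^ 2 / 2 := by
    calc (p - q) ^ 2 / 4608 = (|p - q| / 36 * (3 / 4)) ^ 2 / 2 := by
          rw [mul_pow, div_pow, sq_abs]; ring
      _ ≤ _ := by gcongr
  refine hconst.trans ?_
  unfold CausalAlgorithm.mse
  rw [← integral_add (A.integrable_sq_error hp0 k) (A.integrable_sq_error hq0 k)]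
  have := integral_mono
    (integrable_const ((|theta p / 2 - theta q / 2| * affinity p q ^ k) ^ 2 / 2))
    ((A.integrable_sq_error hp0 k).add (A.integrable_sq_error hq0 k)) fun u =>
      two_point_bound hp' hq' (fun x => 2 - (A.f k (x, u)).1) (theta p / 2) (theta q / 2)
  simpa using this

/-! ### One parameter that is hard to estimate at all scales -/

/-- The frames whose sample size is informative at the scale `3 ^ (-j)` but not at finer ones:
`{0}` for `j = 0` and `[9 ^ (j - 1), 9 ^ j)` for `j ≥ 1`. -/
def frameBlock (j : ℕ) : Finset ℕ :=
  if j = 0 then {0} else Finset.Ico (9 ^ (j - 1)) (9 ^ j)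

lemma sum_frameBlock (f : ℕ → ℝ) (j : ℕ) :
    ∑ i ∈ Finset.range (j + 1), ∑ k ∈ frameBlock i, f k = ∑ k ∈ Finset.range (9 ^ j), f k := by
  induction j with
  | zero => simp [frameBlock]
  | succ j ih =>
    rw [Finset.sum_range_succ, ih, frameBlock, if_neg (Nat.succ_ne_zero j), Nat.add_sub_cancel,
      Finset.sum_range_add_sum_Ico]
    exact Nat.pow_le_pow_right (by norm_num) (Nat.le_succ j)

lemma lt_of_mem_frameBlock {j k : ℕ} (hk : k ∈ frameBlock j) : k < 9 ^ j := by
  unfold frameBlock at hk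
  split_ifs at hk with h
  · simp_all
  · exact (Finset.mem_Ico.1 hk).2

lemma le_card_frameBlock (j : ℕ) : (9 : ℝ) ^ j / 2 ≤ (frameBlock j).card := by
  cases j with
  | zero => norm_num [frameBlock]
  | succ j =>
    rw [frameBlock, if_neg (Nat.succ_ne_zero j), Nat.card_Ico, Nat.add_sub_cancel, Nat.cast_sub
      (Nat.pow_le_pow_right (by norm_num) (Nat.le_succ j))]
    push_cast
    rw [pow_succ]
    linarith [show (0 : ℝ) < 9 ^ j by positivity]

/-- The interval of length `3 ^ (-j) / 2` with left end `a`. -/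
def scaleInterval (j : ℕ) (a : ℝ) : Set ℝ := Set.Icc a (a + (1 / 3) ^ j / 2)

/-- A lower bound for the total mean square error over a block at a hard parameter: half the
product of the least number `9 ^ j / 2` of frames in block `j` and the least two-point bound
`(3 ^ (-j) / 6) ^ 2 / 4608` for parameters in opposite thirds of an interval at scale `j`. -/
noncomputable def blockLoss : ℝ := 1 / 663552

/-- Two points in the outer thirds of an interval at scale `3 ^ (-j)` cannot both be estimated
well in block `j`; hence in one of the outer thirds every point is estimated badly. -/
lemma CausalAlgorithm.exists_hard_third (A : CausalAlgorithm) (j : ℕ) {a : ℝ}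
    (ha : scaleInterval j a ⊆ Set.Icc (1 / 4) (3 / 4)) :
    ∃ b, scaleInterval (j + 1) b ⊆ scaleInterval j a ∧
      ∀ q ∈ scaleInterval (j + 1) b, blockLoss ≤ ∑ k ∈ frameBlock j, A.mse q k := by
  have hw : (0 : ℝ) < (1 / 3) ^ j := by positivity
  have h9 : (9 : ℝ) ^ j * ((1 / 3) ^ j) ^ 2 = 1 := by
    rw [← pow_mul, mul_comm j 2, pow_mul, ← mul_pow]
    norm_num
  have hpair : ∀ p ∈ scaleInterval (j + 1) a,
      ∀ q ∈ scaleInterval (j + 1) (a + 2 / 3 * ((1 / 3) ^ j / 2)),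
      2 * blockLoss ≤ ∑ k ∈ frameBlock j, A.mse p k + ∑ k ∈ frameBlock j, A.mse q k := by
    intro p hp q hq
    simp only [scaleInterval, Set.mem_Icc, pow_succ] at hp hq
    have hpI : p ∈ Set.Icc (1 / 4 : ℝ) (3 / 4) := ha ⟨by linarith, by linarith⟩
    have hqI : q ∈ Set.Icc (1 / 4 : ℝ) (3 / 4) := ha ⟨by linarith, by linarith⟩
    have hup : (p - q) ^ 2 ≤ ((1 / 3) ^ j) ^ 2 / 4 := by nlinarith
    have hlow : ((1 / 3) ^ j) ^ 2 / 36 ≤ (p - q) ^ 2 := by nlinarith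
    rw [← Finset.sum_add_distrib]
    have hterm : ∀ k ∈ frameBlock j, (p - q) ^ 2 / 4608 ≤ A.mse p k + A.mse q k :=
      fun k hk => A.two_point_mse hpI hqI <| by
        have hk' : (k : ℝ) ≤ 9 ^ j := by exact_mod_cast (lt_of_mem_frameBlock hk).le
        calc (k : ℝ) * (p - q) ^ 2 ≤ 9 ^ j * (((1 / 3) ^ j) ^ 2 / 4) := by gcongr
          _ = 1 / 4 := by linarith
    have hsum := Finset.card_nsmul_le_sum _ _ _ hterm
    rw [nsmul_eq_mul] at hsum
    refine le_trans ?_ hsum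
    calc 2 * blockLoss = 9 ^ j / 2 * (((1 / 3) ^ j) ^ 2 / 36 / 4608) := by
          rw [blockLoss]; linear_combination (-1 / 331776) * h9
      _ ≤ _ := by
          gcongr
          exact le_card_frameBlock j
  by_cases hleft : ∀ p ∈ scaleInterval (j + 1) a, blockLoss ≤ ∑ k ∈ frameBlock j, A.mse p k
  · refine ⟨a, Set.Icc_subset_Icc_right ?_, hleft⟩
    rw [pow_succ]
    linarith
  · push Not at hleft
    obtain ⟨p, hp, hlt⟩ := hleft
    refine ⟨a + 2 / 3 * ((1 / 3) ^ j / 2), Set.Icc_subset_Icc ?_ ?_, fun q hq => ?_⟩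
    · linarith
    · rw [pow_succ]
      linarith
    · linarith [hpair p hp q hq]

/-- Nesting the hard thirds gives one parameter for which every block contributes. -/
lemma CausalAlgorithm.exists_hard_parameter (A : CausalAlgorithm) :
    ∃ q ∈ Set.Icc (1 / 4 : ℝ) (3 / 4),
      ∀ j, blockLoss ≤ ∑ k ∈ frameBlock j, A.mse q k := by
  choose! next hnext hhard using fun j a => A.exists_hard_third j (a := a)
  let a : ℕ → ℝ := fun j => Nat.rec (1 / 4) next j
  have hsub : ∀ j, scaleInterval j (a j) ⊆ Set.Icc (1 / 4) (3 / 4) := fun j => by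
    induction j with
    | zero => exact Set.Icc_subset_Icc le_rfl (by norm_num [a])
    | succ j ih => exact (hnext j (a j) ih).trans ih
  obtain ⟨q, hq⟩ := IsCompact.nonempty_iInter_of_sequence_nonempty_isCompact_isClosed
    (fun j => scaleInterval j (a j)) (fun j => hnext j (a j) (hsub j))
    (fun j => Set.nonempty_Icc.2 (by linarith [show (0 : ℝ) < (1 / 3) ^ j by positivity]))
    isCompact_Icc fun j => isClosed_Icc
  rw [Set.mem_iInter] at hq
  exact ⟨q, hsub 0 (hq 0), fun j => hhard j (a j) (hsub j) q (hq (j + 1))⟩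

/-- The frames before `K` contain about `log K / log 9` complete blocks. -/
lemma blockLoss_mul_log_le_sum {f : ℕ → ℝ} (hf : ∀ k, 0 ≤ f k)
    (hblock : ∀ j, blockLoss ≤ ∑ k ∈ frameBlock j, f k) {K : ℕ} (hK : 1 ≤ K) :
    blockLoss / Real.log 9 * Real.log K ≤ ∑ k ∈ Finset.range K, f k := by
  have h9 : 0 < Real.log 9 := Real.log_pos (by norm_num)
  have hb : 0 < blockLoss := by norm_num [blockLoss]
  set j := Nat.log 9 K
  have hlog : Real.log K ≤ (j + 1 : ℕ) * Real.log 9 := by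
    rw [← Real.log_pow]
    refine Real.log_le_log (by exact_mod_cast hK) ?_
    exact_mod_cast (Nat.lt_pow_succ_log_self (by norm_num) K).le
  calc blockLoss / Real.log 9 * Real.log K
      ≤ blockLoss / Real.log 9 * ((j + 1 : ℕ) * Real.log 9) := by gcongr
    _ = (j + 1 : ℕ) * blockLoss := by field_simp
    _ ≤ ∑ i ∈ Finset.range (j + 1), ∑ k ∈ frameBlock i, f k := by
        simpa using Finset.card_nsmul_le_sum (Finset.range (j + 1)) _ _ fun i _ => hblock i
    _ = ∑ k ∈ Finset.range (9 ^ j), f k := sum_frameBlock f j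
    _ ≤ ∑ k ∈ Finset.range K, f k :=
        Finset.sum_le_sum_of_subset_of_nonneg
          (Finset.range_mono (Nat.pow_log_le_self 9 (by omega))) fun k _ _ => hf k

end RenewalConverse

theorem mainTheorem3 :
    ∃ c : ℝ, 0 < c ∧
      ∀ A : RenewalConverse.CausalAlgorithm,
        ∃ q : ℝ, q ∈ Set.Icc (1 / 4 : ℝ) (3 / 4) ∧
          ∀ (Ω : Type*) [MeasurableSpace Ω] (μ : Measure Ω) [IsProbabilityMeasure μ]
            (S : ℕ → Ω → Fin 2) (U : Ω → unitInterval),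
            (∀ k, Measurable (S k)) →
            iIndepFun S μ →
            (∀ k, μ {ω | S k ω = 1} = ENNReal.ofReal q) →
            Measurable U →
            μ.map U = volume →
            IndepFun U (fun ω k => S k ω) μ →
            RenewalConverse.optimalRatio μ S = 2 - 2 / q * (-1 + Real.sqrt (1 + q)) ∧
            ∀ K : ℕ, 1 ≤ K →
              RenewalConverse.expectedRatio μ (A.decision S U) K
                ≤ RenewalConverse.optimalRatio μ S - c * (Real.log K / K) := by
  open RenewalConverse in
  have h9 : 0 < Real.log 9 := Real.log_pos (by norm_num)
  have hb : 0 < blockLoss := by norm_num [blockLoss]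
  -- The factor `1 / 8` is the smallest `q`, divided by the longest possible duration of a frame.
  refine ⟨blockLoss / Real.log 9 / 8, by positivity, fun A => ?_⟩
  obtain ⟨q, hq, hblock⟩ := A.exists_hard_parameter
  refine ⟨q, hq, fun Ω _ μ _ S U hS hind hlaw hU hUlaw hUS => ?_⟩
  have hq' : q ∈ Set.Ioo (0 : ℝ) 1 := ⟨by linarith [hq.1], by linarith [hq.2]⟩
  have hopt := optimalRatio_eq_theta hS hq' hlaw
  refine ⟨hopt, fun K hK => ?_⟩
  have hmem := A.decision_mem S U
  have hD := A.measurable_decision hS hU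
  have hK' : (0 : ℝ) < K := by exact_mod_cast hK
  obtain ⟨hT1, hT2⟩ := totalDuration_mem_Icc (μ := μ) hD hmem K
  have hlog := blockLoss_mul_log_le_sum (A.mse_nonneg ⟨hq'.1.le, hq'.2.le⟩) hblock hK
  have hlogK : 0 ≤ Real.log K := Real.log_natCast_nonneg K
  rw [hopt, expectedRatio_eq hS hq' hlaw hD hmem hK]
  simp only [expectedLoss_decision A hS hind hq' hlaw hU hUlaw hUS]
  rw [← Finset.mul_sum]
  gcongr
  calc blockLoss / Real.log 9 / 8 * (Real.log K / K)
      = 1 / 4 * (blockLoss / Real.log 9 * Real.log K) / (2 * K) := by field_simp; ring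
    _ ≤ q * (∑ k ∈ Finset.range K, A.mse q k) / totalDuration μ (A.decision S U) K := by
        have hT0 := hK'.trans_le hT1
        have hnum := mul_le_mul hq.1 hlog (by positivity) hq'.1.le
        exact div_le_div₀ ((by positivity : (0 : ℝ) ≤ _).trans hnum) hnum hT0 hT2
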